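/- Let $R$ be a commutative Noetherian ring, $\mathfrak a$ an ideal of $R$, and $X$ an arbitrary $R$-module (not necessarily finitely generated). Write $H^i_{\mathfrak a}(X)$ for the $i$-th local cohomology module of $X$ with respect to $\mathfrak a$. Let $\mathcal S$ be a Serre subcategory of the category of $R$-modules, that is, a class of $R$-modules containing $0$ such that for every exact sequence $0\to X'\to Y\to X''\to 0$ one has $Y\in\mathcal S$ if and only if $X',X''\in\mathcal S$. Let $\mathrm{cd}_{\mathcal S}(\mathfrak a,X)$ be the largest integer $i$ such that $H^i_{\mathfrak a}(X)\notin\mathcal S$ (with value $-\infty$ if there is no such $i$, and $+\infty$ if there are arbitrarily large ones). Write $\mathrm{cd}(\mathfrak a,X)$ for $\mathrm{cd}_{\mathcal S}(\mathfrak a,X)$ when $\mathcal S$ consists of the zero modules, and $\mathrm q_{\mathfrak a}(X)$ when $\mathcal S$ consists of the Artinian modules. An $R$-module is *coatomic* if each of its proper submodules is contained in a maximal submodule, and *minimax* if it has a finitely generated submodule with Artinian quotient. 1. If $\mathrm{cd}_{\mathcal S}(\mathfrak a,X)>0$, then $d=\mathrm{cd}_{\mathcal S}(\mathfrak a,X)$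 is finite and $H^{d}_{\mathfrak a}(X)/T$ is not finitely generated for any submodule $T$ of $H^{d}_{\mathfrak a}(X)$ with $T\in\mathcal S$. In particular, $H^{d}_{\mathfrak a}(X)$ is not finitely generated. 2. If $\mathrm{cd}(\mathfrak a,X)>0$, then $d=\mathrm{cd}(\mathfrak a,X)$ is finite and $H^{d}_{\mathfrak a}(X)/T$ is not coatomic for any proper submodule $T$ of $H^{d}_{\mathfrak a}(X)$. In particular, $H^{d}_{\mathfrak a}(X)$ is not coatomic. 3. If $\mathrm q_{\mathfrak a}(X)>0$, then $d=\mathrm q_{\mathfrak a}(X)$ is finite and $H^{d}_{\mathfrak a}(X)/T$ is not minimax for any Artinian submodule $T$ of $H^{d}_{\mathfrak a}(X)$. In particular, $H^{d}_{\mathfrak a}(X)$ is not minimax. -/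

import Mathlib

open CategoryTheory

universe u

/-- A module is minimax if it has a finitely generated submodule with Artinian quotient. -/
def IsMinimaxModule (R : Type*) [CommRing R] (M : Type*) [AddCommGroup M] [Module R M] : Prop :=
  ∃ N : Submodule R M, N.FG ∧ IsArtinian R (M ⧸ N)

/-- A module is coatomic if every proper submodule is contained in a maximal submodule. -/
def IsCoatomicModule (R : Type*) [CommRing R] (M : Type*) [AddCommGroup M] [Module R M] : Prop :=
  ∀ N : Submodule R M, N ≠ ⊤ → ∃ P : Submodule R M, IsCoatom P ∧ N ≤ P

/-- The class of zero `R`-modules. -/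
def zeroModules (R : Type u) [CommRing R] : ObjectProperty (ModuleCat.{u} R) :=
  fun M => Subsingleton M

/-- The class of Artinian `R`-modules. -/
def artinianModules (R : Type u) [CommRing R] : ObjectProperty (ModuleCat.{u} R) :=
  fun M => IsArtinian R M

/-- The `S`-cohomological dimension of `X` with respect to `I`: the largest `i` such that the
`i`-th local cohomology module of `X` with support in `I` does not lie in `S`.
It is `⊥` if there is no such `i`, and `⊤` if there are arbitrarily large ones. -/
noncomputable def cohomDimWrt {R : Type u} [CommRing R] (S : ObjectProperty (ModuleCat.{u} R))
    (I : Ideal R) (X : ModuleCat.{u} R) : WithBot ℕ∞ :=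
  ⨆ i ∈ {i : ℕ | ¬ S ((localCohomology I i).obj X)}, (i : WithBot ℕ∞)

/-- The cohomological dimension: the largest `i` with nonzero `i`-th local cohomology. -/
noncomputable def cohomDim {R : Type u} [CommRing R] (I : Ideal R) (X : ModuleCat.{u} R) :
    WithBot ℕ∞ :=
  cohomDimWrt (zeroModules R) I X

/-- The largest `i` for which the `i`-th local cohomology module is not Artinian. -/
noncomputable def artinianCohomDim {R : Type u} [CommRing R] (I : Ideal R) (X : ModuleCat.{u} R) :
    WithBot ℕ∞ :=
  cohomDimWrt (artinianModules R) I X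

/-! Let H be the local cohomology module in degree d > 0, where d is the largest degree in which
local cohomology lies outside `S`. The heart of the matter is that H / I H lies in `S`
(`quotient_smul_top_mem`).

Take an injective resolution E of X and a list l generating I, so that local cohomology is the
cohomology of the torsion complex Γ_I E (`nonempty_linearEquiv_coh_tors`). Let K be the iterated
cone of the multiplications by the members of l, a Koszul construction. Adjoining one generator x to
the torsion condition gives an inclusion of complexes on whose cokernel x acts bijectively, by
injectivity and Artin–Rees; the cone of x therefore makes this cokernel acyclic. As E, and so K(E),
is exact in positive degrees, K(Γ_I E) is too (`kos_tors_exactIn`), and this is where d > 0 enters.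
On the other hand, the long exact sequences of the cones show that if degree d of K(Γ_I E) and all
higher cohomology of Γ_I E are in `S`, then so is H / I H (`coh_quotient_mem`).

The rest is a Nakayama argument. If I is locally nilpotent on M, M / I M is in `S`, and M / F is in
`S` for a finitely generated F, then some I^k kills F while M / I^k F is in `S`, so M is in `S`
(`of_fg_of_quotient`). With M = H / T this excludes finitely generated quotients, and for Artinian
modules it excludes minimax ones. For the zero class I H = H, whereas every maximal submodule
contains I H; hence H has no maximal submodule. Finiteness of d holds because local cohomology
vanishes above the number of generators of I.

Throughout, the index i stands for cohomological degree i + 1. -/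

/-! ### Complexes, iterated cones and relative acyclicity. -/

/-- A `ℤ`-graded cochain complex of `R`-modules, whose differential has degree one. -/
structure LinCochain (R : Type u) [CommRing R] where
  /-- the graded pieces -/
  X : ℤ → ModuleCat.{u} R
  /-- the differential -/
  d : ∀ i, X i →ₗ[R] X (i + 1)
  d_d : ∀ i x, d (i + 1) (d i x) = 0

namespace LinCochain

variable {R : Type u} [CommRing R]

/-- Morphisms of complexes. -/
structure Hom (A B : LinCochain R) where
  /-- the components of the morphism -/
  f : ∀ i, A.X i →ₗ[R] B.X i
  comm : ∀ i x, f (i + 1) (A.d i x) = B.d i (f i x)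

/-- The cocycles of `C` in degree `i + 1`. -/
abbrev cocycles (C : LinCochain R) (i : ℤ) : Submodule R (C.X (i + 1)) :=
  LinearMap.ker (C.d (i + 1))

/-- The cohomology of `C` in degree `i + 1`. -/
abbrev coh (C : LinCochain R) (i : ℤ) : Type u :=
  C.cocycles i ⧸ (LinearMap.range (C.d i)).submoduleOf (C.cocycles i)

/-- The class in degree `i + 1` of a cocycle. -/
def cls (C : LinCochain R) (i : ℤ) : C.cocycles i →ₗ[R] C.coh i :=
  Submodule.mkQ _

lemma cls_surjective (C : LinCochain R) (i : ℤ) : Function.Surjective (C.cls i) :=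
  Submodule.mkQ_surjective _

lemma cls_eq_zero_iff (C : LinCochain R) (i : ℤ) (z : C.cocycles i) :
    C.cls i z = 0 ↔ ∃ w, C.d i w = z := by
  unfold cls
  rw [Submodule.mkQ_apply, Submodule.Quotient.mk_eq_zero]
  exact Iff.rfl

/-- Vanishing of the cohomology of `C` in degree `i + 1`. -/
def ExactIn (C : LinCochain R) (i : ℤ) : Prop :=
  ∀ z, C.d (i + 1) z = 0 → ∃ w, C.d i w = z

lemma ExactIn.subsingleton {C : LinCochain R} {i : ℤ} (h : C.ExactIn i) :
    Subsingleton (C.coh i) := by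
  refine subsingleton_of_forall_eq 0 fun y => ?_
  obtain ⟨z, rfl⟩ := C.cls_surjective i y
  exact (C.cls_eq_zero_iff i z).2 (h z z.2)

/-- The mapping cocone of multiplication by `x` on `C`, up to a shift. -/
def cone (x : R) (C : LinCochain R) : LinCochain R where
  X i := ModuleCat.of R (C.X (i + 1) × C.X i)
  d i := LinearMap.prod (-(C.d (i + 1) ∘ₗ LinearMap.fst R _ _))
    (x • LinearMap.fst R (C.X (i + 1)) (C.X i) + C.d i ∘ₗ LinearMap.snd R _ _)
  d_d i p := by
    apply Prod.ext
    · simp [C.d_d]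
    · simp [C.d_d]

lemma cone_d (x : R) (C : LinCochain R) (i : ℤ) (u : C.X (i + 1)) (v : C.X i) :
    (C.cone x).d i (u, v) = (-C.d (i + 1) u, x • u + C.d i v) := rfl

/-- Functoriality of the cone. -/
def Hom.cone (x : R) {A B : LinCochain R} (f : Hom A B) : Hom (A.cone x) (B.cone x) where
  f i := LinearMap.prodMap (f.f (i + 1)) (f.f i)
  comm i p := by
    apply Prod.ext
    · change f.f (i + 1 + 1) (-A.d (i + 1) p.1) = -B.d (i + 1) (f.f (i + 1) p.1)
      rw [map_neg, f.comm]
    · change f.f (i + 1) (x • p.1 + A.d i p.2) = x • f.f (i + 1) p.1 + B.d i (f.f i p.2)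
      rw [map_add, map_smul, f.comm]

/-- Iterated cones along a list of ring elements. -/
def kos : List R → LinCochain R → LinCochain R
  | [], C => C
  | x :: l, C => kos l (C.cone x)

/-- Functoriality of the iterated cones. -/
def Hom.kos : ∀ (l : List R) {A B : LinCochain R}, Hom A B → Hom (A.kos l) (B.kos l)
  | [], _, _, f => f
  | x :: l, _, _, f => Hom.kos l (f.cone x)

/-- Injectivity of a morphism in every degree. -/
def Hom.Inj {A B : LinCochain R} (f : Hom A B) : Prop :=
  ∀ i, Function.Injective (f.f i)

/-- Acyclicity of the cokernel of a morphism. -/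
def Hom.RelAcyclic {A B : LinCochain R} (f : Hom A B) : Prop :=
  ∀ i (b : B.X (i + 1)), (∃ a, f.f _ a = B.d _ b) → ∃ b' a, b = B.d i b' + f.f _ a

/-- Bijectivity of multiplication by `x` on the cokernel of a morphism. -/
structure Hom.RelBijective {A B : LinCochain R} (f : Hom A B) (x : R) : Prop where
  inj : ∀ i (b : B.X i), (∃ a, f.f i a = x • b) → ∃ a, f.f i a = b
  surj : ∀ i (b : B.X i), ∃ b' a, b = x • b' + f.f i a

variable {A B : LinCochain R} {f : Hom A B}

lemma Hom.Inj.cone (hf : f.Inj) (x : R) : (f.cone x).Inj :=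
  fun i => Prod.map_injective.2 ⟨hf (i + 1), hf i⟩

lemma Hom.Inj.kos (l : List R) : ∀ {A B : LinCochain R} {f : Hom A B}, f.Inj → (f.kos l).Inj := by
  induction l with
  | nil => exact fun h => h
  | cons x l ih => exact fun h => ih (h.cone x)

lemma Hom.RelAcyclic.cone (hf : f.RelAcyclic) (x : R) : (f.cone x).RelAcyclic := by
  rintro i ⟨u, v⟩ ⟨⟨a, a'⟩, h⟩
  have h1 : f.f _ a = -B.d (i + 1 + 1) u := congrArg Prod.fst h
  have h2 : f.f _ a' = x • u + B.d (i + 1) v := congrArg Prod.snd h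
  obtain ⟨u', c, hu⟩ := hf _ u ⟨-a, by rw [map_neg, h1, neg_neg]⟩
  obtain ⟨v', c', hv⟩ := hf _ (x • u' + v) ⟨a' - x • c, by
    rw [map_sub, h2, map_smul, map_add, map_smul, hu, smul_add]; abel⟩
  refine ⟨(-u', v'), (c, c'), Prod.ext ?_ ?_⟩
  · change u = -B.d (i + 1) (-u') + f.f _ c
    rw [map_neg, neg_neg, hu]
  · change v = (x • (-u') + B.d i v') + f.f _ c'
    rw [add_assoc, ← hv, smul_neg]; abel

lemma Hom.RelAcyclic.kos (l : List R) : ∀ {A B : LinCochain R} {f : Hom A B},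
    f.RelAcyclic → (f.kos l).RelAcyclic := by
  induction l with
  | nil => exact fun h => h
  | cons x l ih => exact fun h => ih (h.cone x)

lemma Hom.RelBijective.cone {x : R} (hf : f.RelBijective x) (y : R) :
    (f.cone y).RelBijective x where
  inj := by
    rintro i ⟨u, v⟩ ⟨⟨a, a'⟩, h⟩
    obtain ⟨c, hc⟩ := hf.inj _ u ⟨a, congrArg Prod.fst h⟩
    obtain ⟨c', hc'⟩ := hf.inj _ v ⟨a', congrArg Prod.snd h⟩
    exact ⟨(c, c'), Prod.ext hc hc'⟩
  surj := by
    rintro i ⟨u, v⟩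
    obtain ⟨u', c, hu⟩ := hf.surj _ u
    obtain ⟨v', c', hv⟩ := hf.surj _ v
    exact ⟨(u', v'), (c, c'), Prod.ext hu hv⟩

/-- The cone of an invertible map is acyclic: modulo A, write v = x w; then (w, 0) is a primitive of
(u, v), as cancelling x shows. -/
lemma Hom.RelBijective.relAcyclic_cone {x : R} (hf : f.RelBijective x) :
    (f.cone x).RelAcyclic := by
  rintro i ⟨u, v⟩ ⟨⟨a, a'⟩, h⟩
  have h2 : f.f _ a' = x • u + B.d (i + 1) v := congrArg Prod.snd h
  obtain ⟨w, c, hw⟩ := hf.surj _ v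
  obtain ⟨c', hc'⟩ := hf.inj _ (u + B.d (i + 1) w) ⟨a' - A.d _ c, by
    rw [map_sub, h2, hw, f.comm, map_add, map_smul, smul_add]; abel⟩
  refine ⟨(w, 0), (c', c), Prod.ext ?_ ?_⟩
  · change u = -B.d (i + 1) w + f.f _ c'
    rw [hc']; abel
  · change v = (x • w + B.d i 0) + f.f _ c
    rw [map_zero, add_zero, hw]

lemma Hom.RelBijective.relAcyclic_kos {x : R} (l : List R) (hx : x ∈ l) :
    ∀ {A B : LinCochain R} {f : Hom A B}, f.RelBijective x → (f.kos l).RelAcyclic := by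
  induction l with
  | nil => simp at hx
  | cons y l ih =>
    intro A B f hf
    rcases List.mem_cons.1 hx with rfl | h
    · exact Hom.RelAcyclic.kos l hf.relAcyclic_cone
    · exact ih h (hf.cone y)

/-- A primitive b of z in B has differential in A, so acyclicity of the cokernel corrects b by a
coboundary to an element of A. -/
lemma Hom.RelAcyclic.exactIn (hf : f.RelAcyclic) (hi : f.Inj) {i : ℤ} (hB : B.ExactIn i) :
    A.ExactIn i := by
  intro z hz
  obtain ⟨b, hb⟩ := hB (f.f _ z) (by rw [← f.comm, hz, map_zero])
  obtain ⟨j, rfl⟩ : ∃ j, i = j + 1 := ⟨i - 1, by ring⟩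
  obtain ⟨b', a, h⟩ := hf j b ⟨z, hb.symm⟩
  refine ⟨a, hi _ ?_⟩
  rw [f.comm, ← hb, h, map_add, B.d_d, zero_add]

/-- The cohomology of the cone is squeezed between that of C in the same degree and in the next,
whence the two hypotheses. -/
lemma ExactIn.cone {C : LinCochain R} {i : ℤ} (h : C.ExactIn i) (h' : C.ExactIn (i + 1)) (x : R) :
    (C.cone x).ExactIn i := by
  rintro ⟨u, v⟩ hz
  have h1 : -C.d (i + 1 + 1) u = 0 := congrArg Prod.fst hz
  have h2 : x • u + C.d (i + 1) v = 0 := congrArg Prod.snd hz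
  obtain ⟨u', hu⟩ := h' u (neg_eq_zero.1 h1)
  obtain ⟨v', hv⟩ := h (x • u' + v) (by rw [map_add, map_smul, hu, h2])
  refine ⟨(-u', v'), Prod.ext ?_ ?_⟩
  · change -C.d (i + 1) (-u') = u
    rw [map_neg, neg_neg, hu]
  · change x • (-u') + C.d i v' = v
    rw [hv, smul_neg]; abel

lemma ExactIn.kos (l : List R) : ∀ {C : LinCochain R} {m : ℤ}, (∀ i, m ≤ i → C.ExactIn i) →
    ∀ i, m ≤ i → (C.kos l).ExactIn i := by
  induction l with
  | nil => exact fun h => h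
  | cons x l ih => exact fun h => ih fun i hi => (h i hi).cone (h (i + 1) (by lia)) x

lemma Hom.RelBijective.surj_pow {x : R} (hf : f.RelBijective x) (k : ℕ) (i : ℤ) (b : B.X i) :
    ∃ b' a, b = x ^ k • b' + f.f i a := by
  induction k with
  | zero => exact ⟨b, 0, by simp⟩
  | succ k ih =>
    obtain ⟨b', a, h⟩ := ih
    obtain ⟨b'', a', h'⟩ := hf.surj i b'
    exact ⟨b'', x ^ k • a' + a, by rw [h, h', map_add, map_smul, smul_add, pow_succ, mul_smul]; abel⟩

lemma Hom.RelBijective.inj_pow {x : R} (hf : f.RelBijective x) (k : ℕ) (i : ℤ) (b : B.X i) :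
    (∃ a, f.f i a = x ^ k • b) → ∃ a, f.f i a = b := by
  induction k with
  | zero => simp
  | succ k ih =>
    rintro ⟨a, h⟩
    exact ih (hf.inj i _ ⟨a, by rw [h, pow_succ', mul_smul]⟩)

/-- Since B is exact in two consecutive degrees, the cohomology of A is that of the cokernel one
degree lower. There x acts bijectively, yet every class of A is killed by a power of x. Each use
costs one degree. -/
lemma Hom.RelBijective.exactIn {x : R} (hf : f.RelBijective x) (hi : f.Inj)
    (ht : ∀ i (a : A.X i), ∃ k : ℕ, x ^ k • a = 0) {m : ℤ} (hB : ∀ i, m ≤ i → B.ExactIn i)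
    (i : ℤ) (him : m + 1 ≤ i) : A.ExactIn i := by
  intro u hu
  obtain ⟨j, rfl⟩ : ∃ j, i = j + 1 := ⟨i - 1, by ring⟩
  obtain ⟨v, hv⟩ := hB _ (by lia) (f.f _ u) (by rw [← f.comm, hu, map_zero])
  obtain ⟨k, hk⟩ := ht _ u
  obtain ⟨w, hw⟩ := hB j (by lia) (x ^ k • v) (by rw [map_smul, hv, ← map_smul, hk, map_zero])
  obtain ⟨w', a, hw'⟩ := hf.surj_pow k _ w
  obtain ⟨c, hc⟩ := hf.inj_pow k _ (v - B.d _ w') ⟨A.d _ a, by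
    rw [smul_sub, ← hw, hw', map_add, map_smul, f.comm]; abel⟩
  exact ⟨c, hi _ (by rw [f.comm, hc, map_sub, B.d_d, sub_zero, hv])⟩

end LinCochain

/-! ### Serre classes and a Nakayama-type criterion. -/

namespace CategoryTheory.ObjectProperty

variable {R : Type u} [CommRing R] (S : ObjectProperty (ModuleCat.{u} R)) [S.IsSerreClass]
  {M N K : Type u} [AddCommGroup M] [Module R M] [AddCommGroup N] [Module R N]
  [AddCommGroup K] [Module R K]

lemma of_linear_injective (f : M →ₗ[R] N) (hf : Function.Injective f) (h : S (ModuleCat.of R N)) :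
    S (ModuleCat.of R M) := by
  have : Mono (ModuleCat.ofHom f) := (ModuleCat.mono_iff_injective _).2 hf
  exact S.prop_of_mono (ModuleCat.ofHom f) h

lemma of_linear_surjective (f : M →ₗ[R] N) (hf : Function.Surjective f)
    (h : S (ModuleCat.of R M)) : S (ModuleCat.of R N) := by
  have : Epi (ModuleCat.ofHom f) := (ModuleCat.epi_iff_surjective _).2 hf
  exact S.prop_of_epi (ModuleCat.ofHom f) h

lemma of_linear_exact (f : M →ₗ[R] N) (g : N →ₗ[R] K) (hfg : Function.Exact f g)
    (hM : S (ModuleCat.of R M)) (hK : S (ModuleCat.of R K)) : S (ModuleCat.of R N) := by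
  let T : ShortComplex (ModuleCat.{u} R) := ShortComplex.mk (ModuleCat.ofHom f) (ModuleCat.ofHom g)
    (by ext x; exact hfg.apply_apply_eq_zero x)
  have hT : T.Exact := (ShortComplex.ShortExact.moduleCat_exact_iff_function_exact T).2 hfg
  exact S.prop_X₂_of_exact hT hM hK

lemma of_subsingleton_module [Subsingleton M] : S (ModuleCat.of R M) :=
  S.prop_of_isZero (ModuleCat.isZero_of_subsingleton _)

/-- A module lies in a Serre class if it is a quotient by a kernel and the image is small. -/
lemma of_linear_ker_le {P : Type u} [AddCommGroup P] [Module R P] (p : M →ₗ[R] P)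
    (hp : Function.Surjective p) (f : M →ₗ[R] N) (h : LinearMap.ker f ≤ LinearMap.ker p)
    (hN : S (ModuleCat.of R N)) : S (ModuleCat.of R P) := by
  have h1 : S (ModuleCat.of R (LinearMap.range f)) :=
    S.of_linear_injective (LinearMap.range f).subtype Subtype.val_injective hN
  have h2 : S (ModuleCat.of R (M ⧸ LinearMap.ker f)) :=
    S.of_linear_injective f.quotKerEquivRange.toLinearMap f.quotKerEquivRange.injective h1
  exact S.of_linear_surjective ((LinearMap.ker f).liftQ p h) (fun y => by
    obtain ⟨x, rfl⟩ := hp y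
    exact ⟨Submodule.Quotient.mk x, rfl⟩) h2

lemma of_sup (A B : Submodule R M) (hA : S (ModuleCat.of R A)) (hB : S (ModuleCat.of R B)) :
    S (ModuleCat.of R (A ⊔ B : Submodule R M)) := by
  have hAB : S (ModuleCat.of R (A × B)) :=
    S.of_linear_exact (LinearMap.inl R A B) (LinearMap.snd R A B)
      (fun ⟨a, b⟩ => by simp [Prod.ext_iff, eq_comm]) hA hB
  have : S (ModuleCat.of R (LinearMap.range (A.subtype.coprod B.subtype))) :=
    S.of_linear_surjective _ (LinearMap.surjective_rangeRestrict (A.subtype.coprod B.subtype)) hAB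
  rwa [LinearMap.range_coprod, Submodule.range_subtype, Submodule.range_subtype] at this

/-- For each y in I, multiplication by y from M to M / B kills L, so its image is a quotient of M /
L; finitely many such images add up to the whole. Keeping B independent of I lets the induction over
generators run. -/
lemma map_mkQ_smul_top {I : Ideal R} (hI : I.FG) (L B : Submodule R M) (hB : I • L ≤ B)
    (h : S (ModuleCat.of R (M ⧸ L))) :
    S (ModuleCat.of R (Submodule.map B.mkQ (I • (⊤ : Submodule R M)))) := by
  revert hB
  refine Submodule.fg_induction (motive := fun I _ => (I • L ≤ B) →
    S (ModuleCat.of R (Submodule.map B.mkQ (I • (⊤ : Submodule R M))))) ?_ ?_ I hI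
  · intro y hy
    let q : M →ₗ[R] (M ⧸ B) := y • B.mkQ
    have e : Submodule.map B.mkQ ((R ∙ y) • (⊤ : Submodule R M)) = LinearMap.range q := by
      rw [Submodule.ideal_span_singleton_smul]
      ext z
      simp only [q, Submodule.map_pointwise_smul, Submodule.mem_smul_pointwise_iff_exists,
        Submodule.mem_map, LinearMap.mem_range, LinearMap.smul_apply]
      exact ⟨fun ⟨_, ⟨m, _, e⟩, e'⟩ => ⟨m, by rw [e, e']⟩, fun ⟨m, e⟩ => ⟨_, ⟨m, trivial, rfl⟩, e⟩⟩
    rw [e]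
    refine S.of_linear_ker_le q.rangeRestrict (LinearMap.surjective_rangeRestrict _) L.mkQ ?_ h
    rw [Submodule.ker_mkQ, LinearMap.ker_rangeRestrict]
    intro m hm
    rw [LinearMap.mem_ker]
    change y • B.mkQ m = 0
    rw [← map_smul, Submodule.mkQ_apply, Submodule.Quotient.mk_eq_zero]
    exact hy (Submodule.smul_mem_smul (Submodule.mem_span_singleton_self y) hm)
  · intro I J _ _ hI hJ hB
    rw [Submodule.sup_smul, Submodule.map_sup]
    rw [Submodule.sup_smul, sup_le_iff] at hB
    exact S.of_sup _ _ (hI hB.1) (hJ hB.2)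

/-- M / I L is an extension of M / I M by I M / I L. -/
lemma quotient_smul_of_quotient {I : Ideal R} (hI : I.FG) (L : Submodule R M)
    (h : S (ModuleCat.of R (M ⧸ L))) (h' : S (ModuleCat.of R (M ⧸ I • (⊤ : Submodule R M)))) :
    S (ModuleCat.of R (M ⧸ I • L)) := by
  refine S.of_linear_exact (Submodule.subtype _)
    ((I • L).mapQ (I • ⊤) LinearMap.id (Submodule.smul_mono le_rfl le_top)) ?_
    (S.map_mkQ_smul_top hI L (I • L) le_rfl h) h'
  intro y
  obtain ⟨m, rfl⟩ := Submodule.mkQ_surjective _ y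
  constructor
  · intro h
    have h : Submodule.Quotient.mk (p := I • (⊤ : Submodule R M)) m = 0 := h
    rw [Submodule.Quotient.mk_eq_zero] at h
    exact ⟨⟨_, Submodule.mem_map_of_mem h⟩, rfl⟩
  · rintro ⟨⟨_, n, hn, rfl⟩, e⟩
    rw [← e]
    exact (Submodule.Quotient.mk_eq_zero _).2 hn

lemma quotient_pow_smul_top {I : Ideal R} (hI : I.FG)
    (h : S (ModuleCat.of R (M ⧸ I • (⊤ : Submodule R M)))) (k : ℕ) :
    S (ModuleCat.of R (M ⧸ I ^ k • (⊤ : Submodule R M))) := by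
  induction k with
  | zero =>
    have : Subsingleton (M ⧸ I ^ 0 • (⊤ : Submodule R M)) := by
      rw [pow_zero, Submodule.one_smul]; infer_instance
    exact S.of_subsingleton_module
  | succ k ih =>
    have := S.quotient_smul_of_quotient hI _ ih h
    rwa [← mul_smul, ← pow_succ'] at this

/-- A module that is finitely generated modulo `S` and satisfies `M / I M ∈ S`, where `I` is
locally nilpotent on `M`, belongs to `S`. -/
lemma of_fg_of_quotient {I : Ideal R} (hI : I.FG)
    (ht : ∀ m : M, ∃ k : ℕ, ∀ r ∈ I ^ k, r • m = 0)
    (h : S (ModuleCat.of R (M ⧸ I • (⊤ : Submodule R M))))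
    (F : Submodule R M) (hF : F.FG) (hMF : S (ModuleCat.of R (M ⧸ F))) :
    S (ModuleCat.of R M) := by
  obtain ⟨k, hk⟩ : ∃ k : ℕ, I ^ k • F ≤ ⊥ := by
    refine Submodule.fg_induction (motive := fun F _ => ∃ k : ℕ, I ^ k • F ≤ ⊥) ?_ ?_ F hF
    · intro m
      obtain ⟨k, hk⟩ := ht m
      refine ⟨k, Submodule.smul_le.2 fun r hr n hn => ?_⟩
      obtain ⟨a, rfl⟩ := Submodule.mem_span_singleton.1 hn
      rw [smul_comm, hk r hr, smul_zero]
      exact Submodule.zero_mem _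
    · rintro A B - - ⟨k, hk⟩ ⟨l, hl⟩
      refine ⟨k + l, ?_⟩
      rw [Submodule.smul_sup, sup_le_iff]
      exact ⟨(Submodule.smul_mono_left (Ideal.pow_le_pow_right (by lia))).trans hk,
        (Submodule.smul_mono_left (Ideal.pow_le_pow_right (by lia))).trans hl⟩
  -- The extension argument is used for the ideal `I ^ k`; as `I ^ k • F` vanishes, the quotient is
  -- M itself.
  have h0 : S (ModuleCat.of R (M ⧸ I ^ k • F)) := by
    exact S.quotient_smul_of_quotient (hI.pow (n := k)) F hMF (S.quotient_pow_smul_top hI h k)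
  refine S.of_linear_injective (I ^ k • F).mkQ ?_ h0
  rw [← LinearMap.ker_eq_bot, Submodule.ker_mkQ]
  exact le_bot_iff.1 hk

end CategoryTheory.ObjectProperty

/-! ### The exact sequence of a cone and reduction modulo the ideal. -/

namespace LinCochain

variable {R : Type u} [CommRing R] (S : ObjectProperty (ModuleCat.{u} R)) [S.IsSerreClass]

/-- The map from the cohomology of `C` to the cohomology of a cone. -/
def cohToCone (x : R) (C : LinCochain R) (i : ℤ) : C.coh i →ₗ[R] (C.cone x).coh i :=
  Submodule.mapQ _ _
    ((LinearMap.inr R (C.X (i + 1 + 1)) (C.X (i + 1)) :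
        C.X (i + 1) →ₗ[R] (C.cone x).X (i + 1)).restrict
      (p := C.cocycles i) (q := (C.cone x).cocycles i)
      fun z hz => by
        change (C.cone x).d (i + 1) (0, z) = 0
        rw [cone_d, LinearMap.mem_ker.1 hz, map_zero, smul_zero, neg_zero, add_zero]; rfl)
    (by
      rintro ⟨z, hz⟩ ⟨w, hw⟩
      refine ⟨(0, w), ?_⟩
      rw [cone_d, hw, map_zero, smul_zero, neg_zero, zero_add]; rfl)

/-- The map from the cohomology of a cone to the cohomology of `C`. -/
def cohOfCone (x : R) (C : LinCochain R) (i : ℤ) : (C.cone x).coh i →ₗ[R] C.coh (i + 1) :=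
  Submodule.mapQ _ _
    ((LinearMap.fst R (C.X (i + 1 + 1)) (C.X (i + 1)) :
        (C.cone x).X (i + 1) →ₗ[R] C.X (i + 1 + 1)).restrict
      (p := (C.cone x).cocycles i) (q := C.cocycles (i + 1))
      fun z (hz : (C.cone x).d (i + 1) z = 0) => neg_eq_zero.1 (congrArg Prod.fst hz))
    (by
      rintro ⟨z, hz⟩ ⟨w, hw⟩
      refine ⟨-w.1, ?_⟩
      rw [map_neg]
      exact congrArg Prod.fst hw)

lemma exact_cohToCone_cohOfCone (x : R) (C : LinCochain R) (i : ℤ) :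
    Function.Exact (C.cohToCone x i) (C.cohOfCone x i) := by
  intro y
  obtain ⟨⟨⟨u, v⟩, hz⟩, rfl⟩ := (C.cone x).cls_surjective i y
  constructor
  · intro h
    obtain ⟨w, hw⟩ := (C.cls_eq_zero_iff _ _).1 h
    change C.d (i + 1) w = u at hw
    have h0 : (C.cone x).d (i + 1) (u, v) = 0 := hz
    have h2 : x • u + C.d (i + 1) v = 0 := congrArg Prod.snd h0
    refine ⟨C.cls i ⟨x • w + v, by rw [LinearMap.mem_ker, map_add, map_smul, hw, h2]⟩, ?_⟩
    rw [← sub_eq_zero]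
    refine ((C.cone x).cls_eq_zero_iff i ⟨((0, x • w + v) - (u, v) : _ × _), _⟩).2 ⟨(w, 0), ?_⟩
    · rw [cone_d]
      refine Prod.ext ?_ ?_
      · change - _ = 0 - u
        rw [hw, zero_sub]
      · change x • w + C.d i 0 = x • w + v - v
        rw [map_zero]; abel
  · rintro ⟨y, h⟩
    obtain ⟨z, rfl⟩ := C.cls_surjective i y
    rw [← h]
    exact (C.cls_eq_zero_iff _ _).2 ⟨0, map_zero _⟩

/-- This is the exactness of the cone sequence at the cohomology of C, in the one direction that is
used. -/
lemma exists_of_cohToCone_eq_zero (x : R) (C : LinCochain R) (i : ℤ) (y : C.coh i)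
    (h : C.cohToCone x i y = 0) : ∃ y', y = x • y' := by
  obtain ⟨z, rfl⟩ := C.cls_surjective i y
  obtain ⟨⟨u, v⟩, hw⟩ := ((C.cone x).cls_eq_zero_iff _ _).1 h
  have h1 : -C.d (i + 1) u = 0 := congrArg Prod.fst hw
  have h2 : x • u + C.d i v = z := congrArg Prod.snd hw
  refine ⟨C.cls i ⟨u, neg_eq_zero.1 h1⟩, ?_⟩
  rw [← map_smul, ← sub_eq_zero, ← map_sub]
  refine (C.cls_eq_zero_iff _ _).2 ⟨v, ?_⟩
  change C.d i v = (z : C.X (i + 1)) - x • u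
  rw [← h2]; abel

lemma coh_cone_mem {C : LinCochain R} {x : R} {i : ℤ} (h : S (ModuleCat.of R (C.coh i)))
    (h' : S (ModuleCat.of R (C.coh (i + 1)))) : S (ModuleCat.of R ((C.cone x).coh i)) :=
  S.of_linear_exact _ _ (C.exact_cohToCone_cohOfCone x i) h h'

/-- If the cohomology of `C` above a given degree and the cohomology of the iterated cone in that
degree lie in `S`, then so does the reduction of the cohomology of `C` in that degree. -/
theorem coh_quotient_mem (l : List R) : ∀ {C : LinCochain R} {i : ℤ},
    (∀ j, i < j → S (ModuleCat.of R (C.coh j))) → S (ModuleCat.of R ((C.kos l).coh i)) →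
    S (ModuleCat.of R (C.coh i ⧸ (Ideal.span {x | x ∈ l} • ⊤ : Submodule R (C.coh i)))) := by
  induction l with
  | nil => exact fun _ h => S.of_linear_surjective _ (Submodule.mkQ_surjective _) h
  | cons x l ih =>
    intro C i hj h
    have h1 := ih (C := C.cone x)
      (fun j hij => coh_cone_mem S (hj j hij) (hj (j + 1) (by lia))) h
    set I := Ideal.span {y | y ∈ l} with hI
    have hIfg : I.FG := by
      classical exact ⟨l.toFinset, by simp [hI]⟩
    set L := LinearMap.range (C.cohToCone x i) with hL
    -- Modulo the image of `C.coh i`, the cohomology of the cone embeds in `C.coh (i + 1)`.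
    have h2 : S (ModuleCat.of R ((C.cone x).coh i ⧸ L)) := by
      refine S.of_linear_injective (L.liftQ (C.cohOfCone x i) ?_) ?_ (hj (i + 1) (by lia))
      · rintro _ ⟨y, rfl⟩
        exact (C.exact_cohToCone_cohOfCone x i).apply_apply_eq_zero y
      · rw [← LinearMap.ker_eq_bot, Submodule.ker_liftQ_eq_bot]
        intro y hy
        exact (C.exact_cohToCone_cohOfCone x i y).1 hy
    -- Reducing by `I • L` matters: its elements, unlike those of I times the whole cohomology of
    -- the cone, lift to `I • ⊤` in `C.coh i`.
    have h3 := S.quotient_smul_of_quotient hIfg L h2 h1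
    refine S.of_linear_ker_le (Submodule.mkQ _) (Submodule.mkQ_surjective _)
      ((I • L).mkQ ∘ₗ C.cohToCone x i) ?_ h3
    intro y hy
    rw [Submodule.ker_mkQ]
    have hL' : I • L = Submodule.map (C.cohToCone x i) (I • ⊤) :=
      (congrArg (I • ·) (LinearMap.range_eq_map _)).trans (Submodule.map_smul'' _ _ _).symm
    rw [LinearMap.ker_comp, Submodule.ker_mkQ, Submodule.mem_comap, hL'] at hy
    obtain ⟨y', hy', e⟩ := hy
    -- After subtracting an element of `I • ⊤`, y dies in the cone, hence is a multiple of the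
    -- remaining generator x.
    obtain ⟨y'', e'⟩ := C.exists_of_cohToCone_eq_zero x i (y - y') (by rw [map_sub, e, sub_self])
    rw [sub_eq_iff_eq_add.1 e']
    refine add_mem (Submodule.smul_mem_smul (Ideal.subset_span (by simp)) trivial)
      (Submodule.smul_mono_left (Ideal.span_mono fun z hz => ?_) hy')
    exact List.mem_cons_of_mem _ hz

end LinCochain

/-! ### Torsion submodules and divisibility of injective modules. -/

section Torsion

variable {R : Type u} [CommRing R]

/-- The submodule of elements annihilated by some power of each element of the list `l`. -/
def listTorsion (l : List R) (M : Type u) [AddCommGroup M] [Module R M] : Submodule R M where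
  carrier := {m | ∀ x ∈ l, ∃ k : ℕ, x ^ k • m = 0}
  zero_mem' := fun _ _ => ⟨0, smul_zero _⟩
  add_mem' := by
    intro a b ha hb x hx
    obtain ⟨k, hk⟩ := ha x hx
    obtain ⟨k', hk'⟩ := hb x hx
    refine ⟨k + k', ?_⟩
    rw [smul_add, pow_add, mul_smul, mul_smul, hk', smul_comm, hk, smul_zero, smul_zero, add_zero]
  smul_mem' := by
    intro r a ha x hx
    obtain ⟨k, hk⟩ := ha x hx
    exact ⟨k, by rw [smul_comm, hk, smul_zero]⟩

variable {M : Type u} [AddCommGroup M] [Module R M]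

lemma mem_listTorsion {l : List R} {m : M} :
    m ∈ listTorsion l M ↔ ∀ x ∈ l, ∃ k : ℕ, x ^ k • m = 0 := Iff.rfl

lemma mem_listTorsion_cons {x : R} {l : List R} {m : M} :
    m ∈ listTorsion (x :: l) M ↔ (∃ k : ℕ, x ^ k • m = 0) ∧ m ∈ listTorsion l M := by
  simp [mem_listTorsion]

lemma span_list_fg (l : List R) : (Ideal.span {x : R | x ∈ l}).FG := by
  classical exact ⟨l.toFinset, by simp⟩

lemma mem_listTorsion_iff_exists_pow {l : List R} {m : M} :
    m ∈ listTorsion l M ↔ ∃ k : ℕ, ∀ r ∈ Ideal.span {x : R | x ∈ l} ^ k, r • m = 0 := by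
  constructor
  · intro h
    obtain ⟨k, hk⟩ := Ideal.exists_pow_le_of_le_radical_of_fg
      (I := Ideal.span {x : R | x ∈ l}) (J := LinearMap.ker (LinearMap.toSpanSingleton R M m))
      (Ideal.span_le.2 fun (x : R) hx => h x hx) (span_list_fg l)
    exact ⟨k, fun r hr => hk hr⟩
  · rintro ⟨k, hk⟩ x hx
    exact ⟨k, hk _ (Ideal.pow_mem_pow (Ideal.subset_span (s := {x : R | x ∈ l}) hx) k)⟩

/-- Over a Noetherian ring, the torsion of an injective module is divisible up to torsion. -/
lemma Module.Baer.exists_sub_smul_torsion [IsNoetherianRing R] (hM : Module.Baer R M)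
    {I : Ideal R} (x : R) {w : M} {k : ℕ} (hw : ∀ r ∈ I ^ k, r • w = 0) :
    ∃ (w' : M) (n s : ℕ), (∀ r ∈ I ^ n, r • w' = 0) ∧ x ^ s • (w - x • w') = 0 := by
  -- The annihilators of the powers of x are constant from the exponent s on; c below is an
  -- Artin–Rees constant for the ideal generated by `x ^ (s + 1)`.
  obtain ⟨s, hs⟩ := monotone_stabilizes_iff_noetherian.2 (inferInstanceAs (IsNoetherian R R))
    ⟨fun s => LinearMap.ker (LinearMap.mulLeft R (x ^ s)),
      monotone_nat_of_le_succ fun s r hr => by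
        simp only [LinearMap.mem_ker, LinearMap.mulLeft_apply] at hr ⊢
        rw [pow_succ', mul_assoc, hr, mul_zero]⟩
  obtain ⟨c, hc⟩ := I.exists_pow_inf_eq_pow_smul (Ideal.span {x ^ (s + 1)})
  -- This makes `x ^ (s + 1) * r + y ↦ x ^ s • r • w` well defined on the ideal (x^(s+1)) + I^(k+c).
  have key : ∀ r : R, x ^ (s + 1) * r ∈ I ^ (k + c) → x ^ s • r • w = 0 := by
    intro r hr
    have h1 : x ^ (s + 1) * r ∈ I ^ k * Ideal.span {x ^ (s + 1)} := by
      have h2 : x ^ (s + 1) * r ∈ (I ^ (k + c) • ⊤ ⊓ Ideal.span {x ^ (s + 1)} : Ideal R) :=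
        ⟨by simpa using hr, Ideal.mul_mem_right _ _ (Ideal.mem_span_singleton_self _)⟩
      rw [hc _ (by lia), Nat.add_sub_cancel] at h2
      exact Submodule.smul_mono le_rfl inf_le_right h2
    obtain ⟨y, hy, e⟩ := Ideal.mem_mul_span_singleton.1 h1
    have h3 : r - y ∈ LinearMap.ker (LinearMap.mulLeft R (x ^ (s + 1))) := by
      rw [LinearMap.mem_ker, LinearMap.mulLeft_apply, mul_sub, ← e]; ring
    have h4 : r - y ∈ LinearMap.ker (LinearMap.mulLeft R (x ^ s)) := (hs (s + 1) (by lia)).ge h3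
    rw [LinearMap.mem_ker, LinearMap.mulLeft_apply, mul_sub, sub_eq_zero] at h4
    rw [← mul_smul, h4, mul_smul, hw y hy, smul_zero]
  let p : (R × ↥(I ^ (k + c))) →ₗ[R] R :=
    (LinearMap.mulLeft R (x ^ (s + 1))).coprod (I ^ (k + c)).subtype
  let q : (R × ↥(I ^ (k + c))) →ₗ[R] M :=
    (x ^ s • LinearMap.toSpanSingleton R M w) ∘ₗ LinearMap.fst R _ _
  have hpq : LinearMap.ker p ≤ LinearMap.ker q := by
    rintro ⟨r, y⟩ h
    have h : x ^ (s + 1) * r + y = 0 := h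
    refine key r ?_
    rw [eq_neg_of_add_eq_zero_left h]
    exact neg_mem y.2
  let g : LinearMap.range p →ₗ[R] M :=
    (LinearMap.ker p).liftQ q hpq ∘ₗ p.quotKerEquivRange.symm.toLinearMap
  have hg : ∀ z, g ⟨p z, z, rfl⟩ = q z := by
    intro z
    have : p.quotKerEquivRange.symm ⟨p z, z, rfl⟩ = Submodule.Quotient.mk z := by
      rw [LinearEquiv.symm_apply_eq]; rfl
    simp only [g, LinearMap.comp_apply, LinearEquiv.coe_coe, this]
    rfl
  -- The value at 1 of the extension is killed by `I ^ (k + c)`, and `x ^ (s + 1)` sends it to `x ^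
  -- s • w`.
  obtain ⟨g', hg'⟩ := hM (LinearMap.range p) g
  have hg'' : ∀ z, g' (p z) = q z := fun z => (hg' _ ⟨z, rfl⟩).trans (hg z)
  have hone : ∀ r : R, r • g' 1 = g' r := fun r => by rw [← map_smul, smul_eq_mul, mul_one]
  refine ⟨g' 1, k + c, s, fun r hr => ?_, ?_⟩
  · have := hg'' (0, ⟨r, hr⟩)
    simpa [p, q, hone] using this
  · have := hg'' (1, 0)
    simp only [p, q, LinearMap.coprod_apply, LinearMap.mulLeft_apply, mul_one, map_zero, add_zero,
      LinearMap.comp_apply, LinearMap.fst_apply, LinearMap.smul_apply,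
      LinearMap.toSpanSingleton_apply, one_smul] at this
    rw [smul_sub, ← mul_smul, ← pow_succ, hone, this, sub_self]

end Torsion

/-! ### The torsion subcomplex of an injective resolution. -/

namespace LinCochain

variable {R : Type u} [CommRing R]

/-- The subcomplex of torsion elements. -/
def tors (l : List R) (C : LinCochain R) : LinCochain R where
  X i := ModuleCat.of R (listTorsion l (C.X i))
  d i := (C.d i).restrict (p := listTorsion l (C.X i)) (q := listTorsion l (C.X (i + 1)))
      fun m hm x hx => by
    obtain ⟨k, hk⟩ := hm x hx
    exact ⟨k, by rw [← map_smul, hk, map_zero]⟩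
  d_d i m := Subtype.ext (C.d_d i m)

/-- The inclusion of torsion subcomplexes. -/
def torsIncl (x : R) (l : List R) (C : LinCochain R) : Hom (C.tors (x :: l)) (C.tors l) where
  f i := Submodule.inclusion (p := listTorsion (x :: l) (C.X i)) (p' := listTorsion l (C.X i))
    fun _ hm => (mem_listTorsion_cons.1 hm).2
  comm _ _ := rfl

lemma torsIncl_inj (x : R) (l : List R) (C : LinCochain R) : (C.torsIncl x l).Inj :=
  fun _ _ _ h => Subtype.ext (congrArg (fun m : listTorsion l _ => m.1) h)

/-- If x b is killed by a power of x, so is b. Conversely, an element of an injective module is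
divisible by x up to x-power torsion, and that error lies in the smaller complex. -/
lemma torsIncl_relBijective [IsNoetherianRing R] (x : R) (l : List R) (C : LinCochain R)
    (hC : ∀ i, Module.Baer R (C.X i)) : (C.torsIncl x l).RelBijective x where
  inj := by
    rintro i b ⟨a, h⟩
    obtain ⟨k, hk⟩ := (mem_listTorsion_cons.1 a.2).1
    have h' : a.1 = x • b.1 := congrArg Subtype.val h
    exact ⟨⟨b.1, mem_listTorsion_cons.2 ⟨⟨k + 1, by rw [pow_succ, mul_smul, ← h', hk]⟩, b.2⟩⟩, rfl⟩
  surj := by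
    intro i b
    obtain ⟨k, hk⟩ := mem_listTorsion_iff_exists_pow.1 b.2
    obtain ⟨w', n, s, h, hs⟩ := (hC i).exists_sub_smul_torsion x hk
    have hw' : w' ∈ listTorsion l (C.X i) := mem_listTorsion_iff_exists_pow.2 ⟨n, h⟩
    refine ⟨⟨w', hw'⟩, ⟨b.1 - x • w', mem_listTorsion_cons.2
      ⟨⟨s, hs⟩, sub_mem b.2 (Submodule.smul_mem _ _ hw')⟩⟩, Subtype.ext ?_⟩
    exact (add_sub_cancel (x • w') b.1).symm

lemma tors_nil_exactIn {C : LinCochain R} {i : ℤ} (h : C.ExactIn i) : (C.tors []).ExactIn i := by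
  intro z hz
  obtain ⟨w, hw⟩ := h z.1 (congrArg Subtype.val hz)
  exact ⟨⟨w, fun _ hx => absurd hx List.not_mem_nil⟩, Subtype.ext hw⟩

/-- The torsion of an injective resolution has no cohomology above the number of generators. -/
lemma tors_exactIn [IsNoetherianRing R] {C : LinCochain R} (hC : ∀ i, Module.Baer R (C.X i))
    {m : ℤ} (h : ∀ i, m ≤ i → C.ExactIn i) (l : List R) :
    ∀ i, m + l.length ≤ i → (C.tors l).ExactIn i := by
  induction l with
  | nil => exact fun i hi => tors_nil_exactIn (h i (by simpa using hi))
  | cons x l ih =>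
    intro i hi
    refine (C.torsIncl_relBijective x l hC).exactIn (C.torsIncl_inj x l) ?_ ih i ?_
    · intro i a
      obtain ⟨k, hk⟩ := (mem_listTorsion_cons.1 a.2).1
      exact ⟨k, Subtype.ext hk⟩
    · rw [List.length_cons] at hi; push_cast at hi; lia

/-- The iterated cones on the torsion of an injective resolution are exact where the resolution
is exact. -/
lemma kos_tors_exactIn [IsNoetherianRing R] {C : LinCochain R} (hC : ∀ i, Module.Baer R (C.X i))
    {m : ℤ} (h : ∀ i, m ≤ i → C.ExactIn i) (l : List R) :
    ∀ i, m ≤ i → ((C.tors l).kos l).ExactIn i := by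
  -- The torsion condition grows along l' while the cones remain those of the full list, so every
  -- adjoined generator has its cone available to kill the cokernel.
  suffices H : ∀ l' : List R, l' ⊆ l → ∀ i, m ≤ i → ((C.tors l').kos l).ExactIn i from
    H l (List.Subset.refl _)
  intro l'
  induction l' with
  | nil => exact fun _ => ExactIn.kos l fun i hi => tors_nil_exactIn (h i hi)
  | cons x l' ih =>
    intro hl i hi
    rw [List.cons_subset] at hl
    exact ((C.torsIncl_relBijective x l' hC).relAcyclic_kos l hl.1).exactIn
      ((C.torsIncl_inj x l').kos l) (ih hl.2 i hi)

lemma coh_tors_torsion {C : LinCochain R} (l : List R) (i : ℤ) (y : (C.tors l).coh i) :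
    ∃ k : ℕ, ∀ r ∈ Ideal.span {x : R | x ∈ l} ^ k, r • y = 0 := by
  obtain ⟨z, rfl⟩ := (C.tors l).cls_surjective i y
  obtain ⟨k, hk⟩ := mem_listTorsion_iff_exists_pow.1 z.1.2
  refine ⟨k, fun r hr => ?_⟩
  rw [← map_smul, show r • z = 0 from Subtype.ext (Subtype.ext (hk r hr)), map_zero]

end LinCochain

/-! ### Comparison of two constructions of Ext. -/

open Limits Opposite

namespace CategoryTheory.ProjectiveResolution

variable {R : Type u} [CommRing R] {N : ModuleCat.{u} R} (P : ProjectiveResolution N)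
  (X : ModuleCat.{u} R) (n : ℕ)

/-- The complex, in the opposite category of modules, that computes `Ext` into `X`. -/
noncomputable abbrev homOpComplex : ChainComplex (ModuleCat.{u} R)ᵒᵖ ℕ :=
  (((linearYoneda R (ModuleCat.{u} R)).obj X).rightOp.mapHomologicalComplex _).obj P.complex

/-- The module of cocycles of the complex of homomorphisms from `P` to `X`. -/
noncomputable abbrev extCocycles : ModuleCat.{u} R := unop ((P.homOpComplex X).opcycles n)

/-- The inclusion of the cocycles in the module of cochains. -/
noncomputable def iExtCocycles : P.extCocycles X n →ₗ[R] (P.complex.X n ⟶ X) :=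
  ((P.homOpComplex X).pOpcycles n).unop.hom

/-- The class of a cocycle in the `Ext` module. -/
noncomputable def extCocyclesπ :
    P.extCocycles X n →ₗ[R] ((Ext R (ModuleCat.{u} R) n).obj (op N)).obj X :=
  (P.isoLeftDerivedObj ((linearYoneda R _).obj X).rightOp n).hom.unop.hom ∘ₗ
    ((P.homOpComplex X).homologyι n).unop.hom

lemma extCocyclesπ_surjective : Function.Surjective (P.extCocyclesπ X n) := by
  have h : Function.Surjective
      (P.isoLeftDerivedObj ((linearYoneda R _).obj X).rightOp n).hom.unop.hom :=
    (ModuleCat.epi_iff_surjective _).1 inferInstance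
  exact h.comp ((ModuleCat.epi_iff_surjective ((P.homOpComplex X).homologyι n).unop).1
    inferInstance)

lemma iExtCocycles_injective : Function.Injective (P.iExtCocycles X n) := by
  have : Mono ((P.homOpComplex X).pOpcycles n).unop := inferInstance
  exact (ModuleCat.mono_iff_injective _).1 this

lemma d_comp_iExtCocycles (z : P.extCocycles X n) :
    P.complex.d (n + 1) n ≫ P.iExtCocycles X n z = 0 := by
  have h := congrArg Quiver.Hom.unop ((P.homOpComplex X).d_pOpcycles (n + 1) n)
  exact ConcreteCategory.congr_hom h z

lemma exists_iExtCocycles_eq (f : P.complex.X n ⟶ X) (hf : P.complex.d (n + 1) n ≫ f = 0) :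
    ∃ z, P.iExtCocycles X n z = f := by
  have h := (ShortComplex.exact_of_g_is_cokernel (ShortComplex.mk _ _
    ((P.homOpComplex X).d_pOpcycles (n + 1) n))
    ((P.homOpComplex X).opcyclesIsCokernel (n + 1) n (by simp))).unop
  exact (ShortComplex.moduleCat_exact_iff _).1 h f hf

lemma extCocyclesπ_eq_zero_iff (z : P.extCocycles X (n + 1)) :
    P.extCocyclesπ X (n + 1) z = 0 ↔ ∃ g : P.complex.X n ⟶ X,
      P.complex.d (n + 1) n ≫ g = P.iExtCocycles X (n + 1) z := by
  have h := (ShortComplex.exact_of_f_is_kernel (ShortComplex.mk _ _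
    ((P.homOpComplex X).homologyι_comp_fromOpcycles (n + 1) n))
    ((P.homOpComplex X).homologyIsKernel (n + 1) n (by simp))).unop
  have hd : ∀ g : P.complex.X n ⟶ X, P.iExtCocycles X (n + 1)
      (((P.homOpComplex X).fromOpcycles (n + 1) n).unop.hom g) = P.complex.d (n + 1) n ≫ g := by
    intro g
    have h := congrArg Quiver.Hom.unop ((P.homOpComplex X).p_fromOpcycles (n + 1) n)
    exact ConcreteCategory.congr_hom h g
  have h0 : P.extCocyclesπ X (n + 1) z = 0 ↔
      ((P.homOpComplex X).homologyι (n + 1)).unop.hom z = 0 := by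
    have hi : Function.Injective
        (P.isoLeftDerivedObj ((linearYoneda R _).obj X).rightOp (n + 1)).hom.unop.hom :=
      (ModuleCat.mono_iff_injective _).1 inferInstance
    exact map_eq_zero_iff _ hi
  rw [h0]
  constructor
  · intro hz
    obtain ⟨g, hg⟩ := (ShortComplex.moduleCat_exact_iff _).1 h z hz
    exact ⟨g, by rw [← hd g]; exact congrArg _ hg⟩
  · rintro ⟨g, hg⟩
    rw [← hd g] at hg
    rw [← P.iExtCocycles_injective X (n + 1) hg]
    exact ConcreteCategory.congr_hom (congrArg Quiver.Hom.unop
      ((P.homOpComplex X).homologyι_comp_fromOpcycles (n + 1) n)) g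

variable {N' : ModuleCat.{u} R} {P' : ProjectiveResolution N'} {P} in
lemma map_extCocyclesπ {u : N' ⟶ N} (φ : Hom P' P u) (z : P.extCocycles X n) :
    ∃ z', P'.iExtCocycles X n z' = φ.hom.f n ≫ P.iExtCocycles X n z ∧
      (((Ext R (ModuleCat.{u} R) n).map u.op).app X).hom (P.extCocyclesπ X n z) =
        P'.extCocyclesπ X n z' := by
  let F := ((linearYoneda R (ModuleCat.{u} R)).obj X).rightOp
  let ψ : P'.homOpComplex X ⟶ P.homOpComplex X := (F.mapHomologicalComplex _).map φ.hom
  refine ⟨(HomologicalComplex.opcyclesMap ψ n).unop.hom z, ?_, ?_⟩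
  · have h := congrArg Quiver.Hom.unop (HomologicalComplex.p_opcyclesMap ψ n)
    exact ConcreteCategory.congr_hom h z
  · have h := isoLeftDerivedObj_hom_naturality u P' P φ.hom
      (φ.hom_f_zero_comp_π_f_zero.trans (by rw [ChainComplex.single₀_map_f_zero]; rfl)) F n
    have h' : ((P.homOpComplex X).homologyι n).unop ≫ (HomologicalComplex.homologyMap ψ n).unop =
        (HomologicalComplex.opcyclesMap ψ n).unop ≫ ((P'.homOpComplex X).homologyι n).unop :=
      congrArg Quiver.Hom.unop (HomologicalComplex.homologyι_naturality ψ n)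
    exact (ConcreteCategory.congr_hom (congrArg Quiver.Hom.unop h)
      (((P.homOpComplex X).homologyι n).unop.hom z)).trans
      (congrArg (P'.isoLeftDerivedObj F n).hom.unop.hom (ConcreteCategory.congr_hom h' z))

lemma smul_extMk (r : R) (f : P.complex.X n ⟶ X) (hf : P.complex.d (n + 1) n ≫ f = 0) :
    r • P.extMk f (n + 1) rfl hf =
      P.extMk (r • f) (n + 1) rfl (by rw [Linear.comp_smul, hf, smul_zero]) := by
  rw [Abelian.Ext.smul_eq_comp_mk₀, P.extMk_comp_mk₀]
  simp only [Linear.comp_smul, Category.comp_id]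

/-- The class of a cocycle in the `Ext` group defined in terms of the derived category. -/
noncomputable def extCocyclesMk : P.extCocycles X n →ₗ[R] Abelian.Ext N X n where
  toFun z := P.extMk (P.iExtCocycles X n z) (n + 1) rfl (P.d_comp_iExtCocycles X n z)
  map_add' z z' := by
    rw [P.add_extMk]; congr 1; exact map_add _ _ _
  map_smul' r z := by
    rw [RingHom.id_apply, P.smul_extMk]; congr 1; exact map_smul _ _ _

lemma extCocyclesMk_surjective : Function.Surjective (P.extCocyclesMk X n) := by
  intro y
  obtain ⟨f, hf, rfl⟩ := P.extMk_surjective y (n + 1) rfl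
  obtain ⟨z, rfl⟩ := P.exists_iExtCocycles_eq X n f hf
  exact ⟨z, rfl⟩

/-- Both kernels consist of the coboundaries, so both Ext modules are the same quotient of the
cocycles. -/
lemma ker_extCocyclesMk :
    LinearMap.ker (P.extCocyclesπ X (n + 1)) = LinearMap.ker (P.extCocyclesMk X (n + 1)) := by
  ext z
  rw [LinearMap.mem_ker, LinearMap.mem_ker, extCocyclesπ_eq_zero_iff]
  exact (P.extMk_eq_zero_iff _ (n + 2) rfl (P.d_comp_iExtCocycles X (n + 1) z) n rfl).symm

/-- The comparison between the two definitions of `Ext` in positive degrees. -/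
noncomputable def extComparison :
    ((Ext R (ModuleCat.{u} R) (n + 1)).obj (op N)).obj X ≃ₗ[R] Abelian.Ext N X (n + 1) :=
  (LinearMap.quotKerEquivOfSurjective _ (P.extCocyclesπ_surjective X (n + 1))).symm ≪≫ₗ
    Submodule.quotEquivOfEq _ _ (P.ker_extCocyclesMk X n) ≪≫ₗ
    LinearMap.quotKerEquivOfSurjective _ (P.extCocyclesMk_surjective X (n + 1))

lemma extComparison_extCocyclesπ (z : P.extCocycles X (n + 1)) :
    P.extComparison X n (P.extCocyclesπ X (n + 1) z) = P.extCocyclesMk X (n + 1) z := by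
  have h : (LinearMap.quotKerEquivOfSurjective _ (P.extCocyclesπ_surjective X (n + 1))).symm
      (P.extCocyclesπ X (n + 1) z) = Submodule.Quotient.mk z := by
    rw [LinearEquiv.symm_apply_eq]; rfl
  simp only [extComparison, LinearEquiv.trans_apply, h]
  rfl

variable {N' : ModuleCat.{u} R} {P' : ProjectiveResolution N'} {P} in
-- Naturality in the first variable is needed because the transition maps in the colimit defining
-- local cohomology come from the maps between the quotients R / I^t.
lemma extComparison_map {u : N' ⟶ N} (φ : Hom P' P u)
    (y : ((Ext R (ModuleCat.{u} R) (n + 1)).obj (op N)).obj X) :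
    P'.extComparison X n ((((Ext R (ModuleCat.{u} R) (n + 1)).map u.op).app X).hom y) =
      (Abelian.Ext.mk₀ u).comp (P.extComparison X n y) (zero_add _) := by
  obtain ⟨z, rfl⟩ := P.extCocyclesπ_surjective X (n + 1) y
  obtain ⟨z', h, h'⟩ := map_extCocyclesπ X (n + 1) φ z
  rw [h', extComparison_extCocyclesπ, extComparison_extCocyclesπ]
  refine Eq.trans ?_
    (mk₀_comp_extMk _ _ rfl (P.d_comp_iExtCocycles X (n + 1) z) φ).symm
  simp only [extCocyclesMk, LinearMap.coe_mk, AddHom.coe_mk, h]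

end CategoryTheory.ProjectiveResolution

/-! ### Filtered colimits of modules. -/

/-- A criterion for the recognition of filtered colimits of modules. -/
lemma ModuleCat.nonempty_linearEquiv_of_isColimit {R : Type u} [CommRing R] {J : Type}
    [Category.{0} J] [IsFiltered J] {F : J ⥤ ModuleCat.{u} R} {c : Cocone F} (hc : IsColimit c)
    {H : Type u} [AddCommGroup H] [Module R H] (a : ∀ j, F.obj j →ₗ[R] H)
    (ha : ∀ {j k} (f : j ⟶ k) y, a k ((F.map f).hom y) = a j y)
    (hsurj : ∀ h, ∃ j y, a j y = h)
    (hker : ∀ j y, a j y = 0 → ∃ (k : J) (f : j ⟶ k), (F.map f).hom y = 0) :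
    Nonempty (c.pt ≃ₗ[R] H) := by
  let c' : Cocone F :=
    { pt := ModuleCat.of R H
      ι := { app j := ModuleCat.ofHom (a j)
             naturality j k f := by ext y; exact ha f y } }
  let b : ∀ j, F.obj j →ₗ[R] c.pt := fun j => (c.ι.app j).hom
  have hfac : ∀ j y, (hc.desc c').hom (b j y) = a j y :=
    fun j y => ConcreteCategory.congr_hom (hc.fac c' j) y
  have hw : ∀ {j k} (f : j ⟶ k) y, b k ((F.map f).hom y) = b j y :=
    fun f y => ConcreteCategory.congr_hom (c.w f) y
  let N : Submodule R c.pt := ⨆ j, LinearMap.range (b j)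
  have hdir : Directed (· ≤ ·) fun j => LinearMap.range (b j) := by
    intro j k
    refine ⟨IsFiltered.max j k, ?_, ?_⟩
    · rintro _ ⟨y, rfl⟩
      exact ⟨_, hw (IsFiltered.leftToMax j k) y⟩
    · rintro _ ⟨y, rfl⟩
      exact ⟨_, hw (IsFiltered.rightToMax j k) y⟩
  have hN : N = ⊤ := by
    -- The projection modulo the sum of the images vanishes on every term of the diagram.
    have h0 : ModuleCat.ofHom N.mkQ = 0 := hc.hom_ext fun j => by
      ext y
      exact (Submodule.Quotient.mk_eq_zero N).2 (Submodule.mem_iSup_of_mem j ⟨y, rfl⟩)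
    rw [eq_top_iff]
    intro x _
    exact (Submodule.Quotient.mk_eq_zero N).1 (ConcreteCategory.congr_hom h0 x)
  refine ⟨LinearEquiv.ofBijective (hc.desc c').hom ⟨?_, fun h => ?_⟩⟩
  · rw [injective_iff_map_eq_zero]
    intro x hx
    have hx' : x ∈ N := hN ▸ Submodule.mem_top
    have : Nonempty J := IsFiltered.nonempty
    obtain ⟨j, y, rfl⟩ := (Submodule.mem_iSup_of_directed _ hdir).1 hx'
    rw [hfac] at hx
    obtain ⟨k, f, hf⟩ := hker j y hx
    rw [← hw f, hf, map_zero]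
  · obtain ⟨j, y, rfl⟩ := hsurj h
    exact ⟨_, hfac j y⟩

lemma LinearMap.exists_comp_eq_of_ker_le {R M N K : Type*} [CommRing R] [AddCommGroup M]
    [Module R M] [AddCommGroup N] [Module R N] [AddCommGroup K] [Module R K] (p : M →ₗ[R] N)
    (hp : Function.Surjective p) (q : M →ₗ[R] K) (h : ker p ≤ ker q) :
    ∃ r : N →ₗ[R] K, ∀ m, r (p m) = q m := by
  refine ⟨(ker p).liftQ q h ∘ₗ (quotKerEquivOfSurjective p hp).symm.toLinearMap, fun m => ?_⟩
  have : (quotKerEquivOfSurjective p hp).symm (p m) = Submodule.Quotient.mk m := by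
    rw [LinearEquiv.symm_apply_eq]; rfl
  simp [this]

/-! ### Ext through injective resolutions, and evaluation of cocycles. -/

namespace CategoryTheory.InjectiveResolution

variable {R : Type u} [CommRing R] {X : ModuleCat.{u} R} (E : InjectiveResolution X)

/-- An injective resolution as a complex of modules graded by the integers. -/
noncomputable def linCochain : LinCochain R where
  X i := E.cochainComplex.X i
  d i := (E.cochainComplex.d i (i + 1)).hom
  d_d i x := ConcreteCategory.congr_hom (E.cochainComplex.d_comp_d i (i + 1) (i + 1 + 1)) x

lemma linCochain_baer (i : ℤ) : Module.Baer R (E.linCochain.X i) := by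
  have h : Injective (E.cochainComplex.X i) := inferInstance
  exact Module.Baer.of_injective
    (Module.injective_module_of_injective_object (inj := h) R _)

lemma linCochain_exactIn (i : ℤ) (hi : 0 ≤ i) : E.linCochain.ExactIn i := by
  have h : E.cochainComplex.ExactAt (i + 1) :=
    E.cochainComplex.exactAt_of_isLE 0 (i + 1) (by lia)
  rw [HomologicalComplex.exactAt_iff' _ i (i + 1) (i + 1 + 1) (by simp) (by simp)] at h
  exact (ShortComplex.moduleCat_exact_iff _).1 h

/-- The identification of the terms of an injective resolution in natural degrees. -/
noncomputable def linCochainEquiv (n : ℕ) (i : ℤ) (h : n = i) :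
    E.cocomplex.X n ≃ₗ[R] E.linCochain.X i :=
  (E.cochainComplexXIso i n h).symm.toLinearEquiv

lemma linCochainEquiv_d (n m : ℕ) (i : ℤ) (h : n = i) (h' : m = i + 1) (y : E.cocomplex.X n) :
    E.linCochainEquiv m (i + 1) h' ((E.cocomplex.d n m).hom y) =
      E.linCochain.d i (E.linCochainEquiv n i h y) := by
  have := E.cochainComplex_d i (i + 1) n m h h'
  have h2 : (E.cochainComplexXIso i n h).inv ≫ E.cochainComplex.d i (i + 1) =
      E.cocomplex.d n m ≫ (E.cochainComplexXIso (i + 1) m h').inv := by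
    rw [this, Iso.inv_hom_id_assoc]
  exact (ConcreteCategory.congr_hom h2 y).symm

/-- The module of cocycles with values in an injective resolution. -/
def homCocycles (N : ModuleCat.{u} R) (n : ℕ) : Submodule R (N ⟶ E.cocomplex.X n) :=
  LinearMap.ker (Linear.rightComp R N (E.cocomplex.d n (n + 1)))

variable {N : ModuleCat.{u} R} {n : ℕ}

lemma mem_homCocycles {f : N ⟶ E.cocomplex.X n} :
    f ∈ E.homCocycles N n ↔ f ≫ E.cocomplex.d n (n + 1) = 0 := Iff.rfl

/-- The class in `Ext` of a cocycle with values in an injective resolution. -/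
noncomputable def homCocyclesMk (N : ModuleCat.{u} R) (n : ℕ) :
    E.homCocycles N n →ₗ[R] Abelian.Ext N X n where
  toFun f := E.extMk f.1 (n + 1) rfl f.2
  map_add' f g := (E.add_extMk _ _ _ _ f.2 g.2).symm
  map_smul' r f := by
    have h := E.mk₀_comp_extMk f.1 (n + 1) rfl f.2 (r • 𝟙 N)
    rw [Abelian.Ext.mk₀_smul, Abelian.Ext.smul_comp, Abelian.Ext.mk₀_id_comp] at h
    rw [RingHom.id_apply, h]
    simp

lemma homCocyclesMk_surjective : Function.Surjective (E.homCocyclesMk N n) := by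
  intro y
  obtain ⟨f, hf, rfl⟩ := E.extMk_surjective y (n + 1) rfl
  exact ⟨⟨f, hf⟩, rfl⟩

lemma homCocyclesMk_eq_zero_iff (f : E.homCocycles N (n + 1)) :
    E.homCocyclesMk N (n + 1) f = 0 ↔
      ∃ g : N ⟶ E.cocomplex.X n, g ≫ E.cocomplex.d n (n + 1) = f :=
  E.extMk_eq_zero_iff f.1 (n + 2) rfl f.2 n rfl

/-- Evaluation of a cocycle on an element of `N` annihilated by a power of the ideal spanned by
the list `l`. -/
noncomputable def evalCocycle (l : List R) (m : listTorsion l N) :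
    E.homCocycles N (n + 1) →ₗ[R] (E.linCochain.tors l).coh n :=
  (E.linCochain.tors l).cls n ∘ₗ
    { toFun f := ⟨⟨E.linCochainEquiv (n + 1) (n + 1) (by simp) (f.1.hom m.1), fun x hx => by
          obtain ⟨k, hk⟩ := m.2 x hx
          exact ⟨k, by rw [← map_smul, ← map_smul, hk, map_zero, map_zero]⟩⟩, Subtype.ext (by
            have h := ConcreteCategory.congr_hom f.2 m.1
            refine (E.linCochainEquiv_d (n + 1) (n + 2) (n + 1) (by simp) (by push_cast; ring)
              (f.1.hom m.1)).symm.trans ?_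
            exact (congrArg _ h).trans (map_zero _))⟩
      map_add' f g := Subtype.ext (Subtype.ext (map_add (E.linCochainEquiv _ _ _) _ _))
      map_smul' r f := Subtype.ext (Subtype.ext (map_smul (E.linCochainEquiv _ _ _) _ _)) }

lemma evalCocycle_eq_cls (l : List R) (m : listTorsion l N) (f : E.homCocycles N (n + 1))
    (z : (E.linCochain.tors l).cocycles n)
    (h : E.linCochainEquiv (n + 1) (n + 1) (by simp) (f.1.hom m.1) = z.1.1) :
    E.evalCocycle l m f = (E.linCochain.tors l).cls n z :=
  congrArg ((E.linCochain.tors l).cls n) (Subtype.ext (Subtype.ext h))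

lemma evalCocycle_congr {N' : ModuleCat.{u} R} (l : List R) (m : listTorsion l N)
    (m' : listTorsion l N') (f : E.homCocycles N (n + 1)) (f' : E.homCocycles N' (n + 1))
    (h : f.1.hom m.1 = f'.1.hom m'.1) : E.evalCocycle l m f = E.evalCocycle l m' f' :=
  E.evalCocycle_eq_cls l m f _ (congrArg _ h)

lemma evalCocycle_eq_zero_iff (l : List R) (m : listTorsion l N) (f : E.homCocycles N (n + 1)) :
    E.evalCocycle l m f = 0 ↔ ∃ w : E.cocomplex.X n, w ∈ listTorsion l (E.cocomplex.X n) ∧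
      (E.cocomplex.d n (n + 1)).hom w = f.1.hom m.1 := by
  refine ((E.linCochain.tors l).cls_eq_zero_iff _ _).trans ⟨?_, ?_⟩
  · rintro ⟨w, hw⟩
    refine ⟨(E.linCochainEquiv n n rfl).symm w.1, fun x hx => ?_, ?_⟩
    · obtain ⟨k, hk⟩ := w.2 x hx
      exact ⟨k, by rw [← map_smul, hk, map_zero]⟩
    · apply (E.linCochainEquiv (n + 1) (n + 1) (by simp)).injective
      rw [E.linCochainEquiv_d n (n + 1) n rfl (by simp), LinearEquiv.apply_symm_apply]
      exact congrArg (fun z : listTorsion l _ => z.1) hw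
  · rintro ⟨w, hw, h⟩
    refine ⟨⟨E.linCochainEquiv n n rfl w, fun x hx => ?_⟩, Subtype.ext ?_⟩
    · obtain ⟨k, hk⟩ := hw x hx
      exact ⟨k, by rw [← map_smul, hk, map_zero]⟩
    · refine (E.linCochainEquiv_d n (n + 1) n rfl (by simp) w).symm.trans ?_
      exact congrArg _ h

/-- A coboundary evaluates at m to the differential of g(m), which is torsion because m is. Thus
evaluation descends to Ext. -/
lemma ker_homCocyclesMk_le (l : List R) (m : listTorsion l N) :
    LinearMap.ker (E.homCocyclesMk N (n + 1)) ≤ LinearMap.ker (E.evalCocycle (n := n) l m) := by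
  intro f hf
  obtain ⟨g, hg⟩ := (E.homCocyclesMk_eq_zero_iff f).1 hf
  refine (E.evalCocycle_eq_zero_iff l m f).2 ⟨g.hom m.1, fun x hx => ?_, ?_⟩
  · obtain ⟨k, hk⟩ := m.2 x hx
    exact ⟨k, by rw [← map_smul, hk, map_zero]⟩
  · exact ConcreteCategory.congr_hom hg m.1

end CategoryTheory.InjectiveResolution

/-! ### Local cohomology as cohomology of the torsion complex. -/

namespace CategoryTheory

/-- The morphism of projective resolutions lifting a given morphism. -/
noncomputable def ProjectiveResolution.liftedHom {C : Type*} [Category* C] [Abelian C] {Y Z : C}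
    (f : Y ⟶ Z) (P : ProjectiveResolution Y) (Q : ProjectiveResolution Z) :
    ProjectiveResolution.Hom P Q f where
  hom := ProjectiveResolution.lift f P Q
  hom_f_zero_comp_π_f_zero :=
    (ProjectiveResolution.lift_commutes_zero f P Q).trans (by
      rw [ChainComplex.single₀_map_f_zero]; rfl)

end CategoryTheory

namespace localCohomology

variable {R : Type u} [CommRing R] (l : List R)

/-- The class of `1` in the quotient by a power of the ideal spanned by `l`. -/
noncomputable def oneTorsion (t : ℕ) :
    listTorsion l (ModuleCat.of R (R ⧸ Ideal.span {x : R | x ∈ l} ^ t)) :=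
  ⟨Submodule.Quotient.mk 1, mem_listTorsion_iff_exists_pow.2 ⟨t, fun r hr => by
    change Submodule.Quotient.mk (r • (1 : R)) = _
    rw [smul_eq_mul, mul_one]
    exact (Submodule.Quotient.mk_eq_zero _).2 hr⟩⟩

lemma exists_hom_one_eq (t : ℕ) {M : ModuleCat.{u} R} (m : M)
    (hm : ∀ r ∈ Ideal.span {x : R | x ∈ l} ^ t, r • m = 0) :
    ∃ f : ModuleCat.of R (R ⧸ Ideal.span {x : R | x ∈ l} ^ t) ⟶ M,
      f.hom (oneTorsion l t).1 = m :=
  ⟨ModuleCat.ofHom (Submodule.liftQ _ (LinearMap.toSpanSingleton R M m) hm),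
    one_smul R m⟩

lemma hom_ext_one {t : ℕ} {M : ModuleCat.{u} R}
    {f g : ModuleCat.of R (R ⧸ Ideal.span {x : R | x ∈ l} ^ t) ⟶ M}
    (h : f.hom (oneTorsion l t).1 = g.hom (oneTorsion l t).1) : f = g := by
  refine ModuleCat.hom_ext (LinearMap.ext fun y => ?_)
  obtain ⟨r, rfl⟩ := Submodule.Quotient.mk_surjective _ y
  have e : (Submodule.Quotient.mk r : R ⧸ Ideal.span {x : R | x ∈ l} ^ t) =
      r • (oneTorsion l t).1 := by
    change _ = Submodule.Quotient.mk (r • (1 : R))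
    rw [smul_eq_mul, mul_one]
  have hf := f.hom.map_smul r (oneTorsion l t).1
  have hg := g.hom.map_smul r (oneTorsion l t).1
  rw [← e] at hf hg
  exact hf.trans ((congrArg (r • ·) h).trans hg.symm)

/-- Local cohomology in positive degrees is the cohomology of the torsion of an injective
resolution. -/
theorem nonempty_linearEquiv_coh_tors {X : ModuleCat.{u} R} (E : InjectiveResolution X) (n : ℕ) :
    Nonempty ((localCohomology (Ideal.span {x : R | x ∈ l}) (n + 1)).obj X ≃ₗ[R]
      (E.linCochain.tors l).coh n) := by
  set I := Ideal.span {x : R | x ∈ l} with hI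
  let D := diagram (idealPowersDiagram I) (n + 1)
  let Q : ℕ → ModuleCat.{u} R := fun t => ModuleCat.of R (R ⧸ I ^ t)
  let P : ∀ t, ProjectiveResolution (Q t) := fun t => projectiveResolution (Q t)
  -- Evaluating cocycles at the class of 1 maps each Ext module to the cohomology of the torsion
  -- complex.
  have hγ : ∀ t, ∃ γ : Abelian.Ext (Q t) X (n + 1) →ₗ[R] (E.linCochain.tors l).coh n,
      ∀ f, γ (E.homCocyclesMk (Q t) (n + 1) f) = E.evalCocycle l (oneTorsion l t) f := fun t =>
    LinearMap.exists_comp_eq_of_ker_le _ E.homCocyclesMk_surjective _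
      (E.ker_homCocyclesMk_le l (oneTorsion l t))
  choose γ hγ using hγ
  have hu : ∀ {s t : ℕ} (u : Q s ⟶ Q t) (f : E.homCocycles (Q t) (n + 1)),
      ∃ f' : E.homCocycles (Q s) (n + 1), f'.1 = u ≫ f.1 ∧
        (Abelian.Ext.mk₀ u).comp (E.homCocyclesMk (Q t) (n + 1) f) (zero_add _) =
          E.homCocyclesMk (Q s) (n + 1) f' := fun u f =>
    ⟨⟨u ≫ f.1, E.mem_homCocycles.2 (by rw [Category.assoc, E.mem_homCocycles.1 f.2, comp_zero])⟩,
      rfl, E.mk₀_comp_extMk f.1 (n + 2) rfl f.2 u⟩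
  let F : ((ℕᵒᵖ)ᵒᵖ) ⥤ ModuleCat.{u} R := D ⋙ (evaluation _ _).obj X
  let a : ∀ j : (ℕᵒᵖ)ᵒᵖ, F.obj j →ₗ[R] (E.linCochain.tors l).coh n := fun j =>
    γ j.unop.unop ∘ₗ ((P j.unop.unop).extComparison X n).toLinearMap
  have := hasColimitDiagram.{u, 0} (idealPowersDiagram I) (n + 1)
  have hc : IsColimit (((evaluation _ _).obj X).mapCocone (colimit.cocone D)) :=
    isColimitOfPreserves _ (colimit.isColimit D)
  have hmap : ∀ {j k : (ℕᵒᵖ)ᵒᵖ} (f : j ⟶ k) (y : F.obj j),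
      (P k.unop.unop).extComparison X n ((F.map f).hom y) =
        (Abelian.Ext.mk₀ ((ringModIdeals (idealPowersDiagram I)).map f.unop)).comp
          ((P j.unop.unop).extComparison X n y) (zero_add _) := fun {j k} f y =>
    ProjectiveResolution.extComparison_map X n
      (ProjectiveResolution.liftedHom ((ringModIdeals (idealPowersDiagram I)).map f.unop)
        (P k.unop.unop) (P j.unop.unop)) y
  refine ModuleCat.nonempty_linearEquiv_of_isColimit hc a ?_ ?_ ?_
  · intro j k f y
    change γ _ ((P k.unop.unop).extComparison X n ((F.map f).hom y)) =
      γ _ ((P j.unop.unop).extComparison X n y)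
    rw [hmap f y]
    obtain ⟨c, hc⟩ := E.homCocyclesMk_surjective ((P j.unop.unop).extComparison X n y)
    rw [← hc]
    obtain ⟨c', h1, h2⟩ := hu ((ringModIdeals (idealPowersDiagram I)).map f.unop) c
    refine (congrArg (γ _) h2).trans ?_
    rw [hγ, hγ]
    exact E.evalCocycle_congr l _ _ c' c (congrArg (fun g => g.hom (oneTorsion l _).1) h1)
  -- Surjectivity: a torsion cocycle is killed by some `I ^ t`, hence is the value at 1 of a map
  -- from R / I^t.
  · intro h
    obtain ⟨z, rfl⟩ := (E.linCochain.tors l).cls_surjective n h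
    let e := E.linCochainEquiv (n + 1) (n + 1) (by simp)
    obtain ⟨t, ht⟩ := mem_listTorsion_iff_exists_pow.1 z.1.2
    obtain ⟨f, hf⟩ := exists_hom_one_eq l t (e.symm z.1.1) fun r hr => by
      rw [← map_smul, ht r hr, map_zero]
    have hz : E.linCochain.d _ z.1.1 = 0 := congrArg (fun m : listTorsion l _ => m.1) z.2
    have hfd : f ∈ E.homCocycles (Q t) (n + 1) := by
      refine E.mem_homCocycles.2 (hom_ext_one l ?_)
      apply (E.linCochainEquiv (n + 2) (n + 1 + 1) (by push_cast; ring)).injective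
      refine (E.linCochainEquiv_d (n + 1) (n + 2) (n + 1) (by simp) (by push_cast; ring) _).trans ?_
      refine (congrArg (fun y => E.linCochain.d _ (e y)) hf).trans ?_
      refine (congrArg (E.linCochain.d _) (e.apply_symm_apply _)).trans (hz.trans ?_)
      exact (map_zero (E.linCochainEquiv _ _ _)).symm
    refine ⟨op (op t), ((P t).extComparison X n).symm (E.homCocyclesMk (Q t) (n + 1) ⟨f, hfd⟩), ?_⟩
    change γ t ((P t).extComparison X n _) = _
    rw [LinearEquiv.apply_symm_apply, hγ]
    exact E.evalCocycle_eq_cls l _ _ z ((congrArg e hf).trans (e.apply_symm_apply _))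
  -- A torsion primitive w of the value at 1 is killed by some `I ^ s`. For an exponent at least s
  -- and that of j, it defines a map whose coboundary is the restricted cocycle.
  · intro j y hy
    obtain ⟨c, hcy⟩ := E.homCocyclesMk_surjective ((P j.unop.unop).extComparison X n y)
    have hy' : γ j.unop.unop ((P j.unop.unop).extComparison X n y) = 0 := hy
    rw [← hcy, hγ, E.evalCocycle_eq_zero_iff] at hy'
    obtain ⟨w, hw, hwd⟩ := hy'
    obtain ⟨s, hs⟩ := mem_listTorsion_iff_exists_pow.1 hw
    let s' := max s j.unop.unop
    let f : j ⟶ op (op s') := (homOfLE (le_max_right s j.unop.unop)).op.op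
    refine ⟨op (op s'), f, ((P s').extComparison X n).map_eq_zero_iff.1 ?_⟩
    refine (hmap f y).trans ?_
    rw [← hcy]
    obtain ⟨c', h1, h2⟩ := hu ((ringModIdeals (idealPowersDiagram I)).map f.unop) c
    refine h2.trans ((E.homCocyclesMk_eq_zero_iff c').2 ?_)
    obtain ⟨g, hg⟩ := exists_hom_one_eq l s' w fun r hr =>
      hs r (Ideal.pow_le_pow_right (le_max_left _ _) hr)
    refine ⟨g, hom_ext_one l ?_⟩
    refine (congrArg (E.cocomplex.d n (n + 1)).hom hg).trans (hwd.trans ?_)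
    exact (congrArg (fun g => g.hom (oneTorsion l _).1) h1).symm

end localCohomology

/-! ### The Serre classes of zero and of Artinian modules. -/

instance zeroModules_isSerreClass (R : Type u) [CommRing R] : (zeroModules R).IsSerreClass where
  exists_zero := ⟨ModuleCat.of R PUnit, ModuleCat.isZero_of_subsingleton _,
    inferInstanceAs (Subsingleton PUnit)⟩
  prop_of_mono f _ h := by
    have : Subsingleton _ := h
    exact ((ModuleCat.mono_iff_injective f).1 inferInstance).subsingleton
  prop_of_epi f _ h := by
    have : Subsingleton _ := h
    exact ((ModuleCat.epi_iff_surjective f).1 inferInstance).subsingleton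
  prop_X₂_of_shortExact {T} hT h₁ h₃ := by
    have : Subsingleton T.X₁ := h₁
    have : Subsingleton T.X₃ := h₃
    refine subsingleton_of_forall_eq (0 : T.X₂) fun y => ?_
    obtain ⟨x, rfl⟩ := (ShortComplex.moduleCat_exact_iff T).1 hT.exact y (Subsingleton.elim _ _)
    rw [Subsingleton.elim x 0, map_zero]

instance artinianModules_isSerreClass (R : Type u) [CommRing R] :
    (artinianModules R).IsSerreClass where
  exists_zero := ⟨ModuleCat.of R PUnit, ModuleCat.isZero_of_subsingleton _,
    inferInstanceAs (IsArtinian R PUnit.{u + 1})⟩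
  prop_of_mono f _ h := by
    have : IsArtinian R _ := h
    exact isArtinian_of_injective f.hom ((ModuleCat.mono_iff_injective f).1 inferInstance)
  prop_of_epi f _ h := by
    have : IsArtinian R _ := h
    exact isArtinian_of_surjective _ f.hom ((ModuleCat.epi_iff_surjective f).1 inferInstance)
  prop_X₂_of_shortExact {T} hT h₁ h₃ := by
    have : IsArtinian R T.X₁ := h₁
    have : IsArtinian R T.X₃ := h₃
    exact isArtinian_of_range_eq_ker T.f.hom T.g.hom hT.exact.moduleCat_range_eq_ker

/-! ### Torsion, vanishing and reduction of local cohomology. -/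

namespace localCohomology

variable {R : Type u} [CommRing R] [IsNoetherianRing R] (I : Ideal R) (X : ModuleCat.{u} R)

lemma exists_list_span_eq : ∃ l : List R, Ideal.span {x : R | x ∈ l} = I := by
  obtain ⟨s, hs⟩ := (isNoetherianRing_iff_ideal_fg R).1 inferInstance I
  exact ⟨s.toList, by simpa using hs⟩

lemma torsion (n : ℕ) (y : (localCohomology I (n + 1)).obj X) :
    ∃ k : ℕ, ∀ r ∈ I ^ k, r • y = 0 := by
  obtain ⟨l, rfl⟩ := exists_list_span_eq I
  obtain ⟨e⟩ := nonempty_linearEquiv_coh_tors l (injectiveResolution X) n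
  obtain ⟨k, hk⟩ := LinCochain.coh_tors_torsion l n (e y)
  exact ⟨k, fun r hr => e.injective (by rw [map_smul, hk r hr, map_zero])⟩

/-- Local cohomology vanishes in large degrees. -/
lemma exists_subsingleton :
    ∃ b : ℕ, ∀ i, b < i → Subsingleton ((localCohomology I i).obj X) := by
  obtain ⟨l, rfl⟩ := exists_list_span_eq I
  refine ⟨l.length, fun i hi => ?_⟩
  obtain ⟨n, rfl⟩ : ∃ n, i = n + 1 := ⟨i - 1, by lia⟩
  let E := injectiveResolution X
  obtain ⟨e⟩ := nonempty_linearEquiv_coh_tors l E n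
  have := (LinCochain.tors_exactIn E.linCochain_baer E.linCochain_exactIn l n (by lia)).subsingleton
  exact e.toEquiv.subsingleton

variable (S : ObjectProperty (ModuleCat.{u} R)) [S.IsSerreClass]

/-- The reduction modulo `I` of the top local cohomology module outside `S` belongs to `S`, if its
degree is positive. -/
theorem quotient_smul_top_mem (n : ℕ)
    (h : ∀ i, n + 1 < i → S ((localCohomology I i).obj X)) :
    S (ModuleCat.of R ((localCohomology I (n + 1)).obj X ⧸
      (I • ⊤ : Submodule R ((localCohomology I (n + 1)).obj X)))) := by
  obtain ⟨l, rfl⟩ := exists_list_span_eq I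
  let E := injectiveResolution X
  have h1 : ∀ j : ℤ, n < j → S (ModuleCat.of R ((E.linCochain.tors l).coh j)) := by
    intro j hj
    obtain ⟨m, rfl⟩ := Int.eq_ofNat_of_zero_le (a := j) (by lia)
    obtain ⟨e⟩ := nonempty_linearEquiv_coh_tors l E m
    exact S.of_linear_injective e.symm.toLinearMap e.symm.injective (h (m + 1) (by lia))
  -- The index n means degree n + 1 > 0, where the iterated cone is exact.
  have h2 : S (ModuleCat.of R (((E.linCochain.tors l).kos l).coh n)) := by
    have := (LinCochain.kos_tors_exactIn E.linCochain_baer E.linCochain_exactIn l n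
      (by lia)).subsingleton
    exact S.of_subsingleton_module
  have h3 := LinCochain.coh_quotient_mem S l h1 h2
  obtain ⟨e⟩ := nonempty_linearEquiv_coh_tors l E n
  refine S.of_linear_surjective (Submodule.mapQ _ _ e.symm.toLinearMap ?_) ?_ h3
  · rw [← Submodule.map_le_iff_le_comap, Submodule.map_smul'']
    exact Submodule.smul_mono le_rfl le_top
  · intro y
    obtain ⟨y, rfl⟩ := Submodule.Quotient.mk_surjective _ y
    exact ⟨Submodule.Quotient.mk (e y), congrArg Submodule.Quotient.mk (e.symm_apply_apply y)⟩

variable {I X S}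

/-- If the local cohomology modules above a positive degree lie in `S`, and the one in that degree
is finitely generated up to modules in `S`, then the latter lies in `S`. -/
theorem mem_of_fg_quotient {n : ℕ} (h : ∀ i, n + 1 < i → S ((localCohomology I i).obj X))
    {T : Submodule R ((localCohomology I (n + 1)).obj X)} (hT : S (ModuleCat.of R T))
    {F : Submodule R ((localCohomology I (n + 1)).obj X ⧸ T)} (hF : F.FG)
    (hTF : S (ModuleCat.of R (((localCohomology I (n + 1)).obj X ⧸ T) ⧸ F))) :
    S ((localCohomology I (n + 1)).obj X) := by
  refine S.of_linear_exact T.subtype T.mkQ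
    (LinearMap.exact_iff.2 (by rw [Submodule.ker_mkQ, Submodule.range_subtype])) hT ?_
  refine S.of_fg_of_quotient ((isNoetherianRing_iff_ideal_fg R).1 inferInstance I) ?_ ?_ F hF hTF
  · intro y
    obtain ⟨y, rfl⟩ := T.mkQ_surjective y
    obtain ⟨k, hk⟩ := torsion I X n y
    exact ⟨k, fun r hr => by rw [← map_smul, hk r hr, map_zero]⟩
  · refine S.of_linear_surjective (Submodule.mapQ _ _ T.mkQ ?_) ?_ (quotient_smul_top_mem I X S n h)
    · rw [← Submodule.map_le_iff_le_comap, Submodule.map_smul'']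
      exact Submodule.smul_mono le_rfl le_top
    · intro y
      obtain ⟨y, rfl⟩ := Submodule.Quotient.mk_surjective _ y
      obtain ⟨y, rfl⟩ := T.mkQ_surjective y
      exact ⟨Submodule.Quotient.mk y, rfl⟩

/-- A positive cohomological dimension is attained. -/
theorem exists_cohomDimWrt_eq (h : 0 < cohomDimWrt S I X) :
    ∃ n : ℕ, cohomDimWrt S I X = (n + 1 : ℕ) ∧ ¬ S ((localCohomology I (n + 1)).obj X) ∧
      ∀ i, n + 1 < i → S ((localCohomology I i).obj X) := by
  let A := {i : ℕ | ¬ S ((localCohomology I i).obj X)}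
  have hbdd : BddAbove A := by
    obtain ⟨b, hb⟩ := exists_subsingleton I X
    refine ⟨b, fun i hi => not_lt.1 fun hbi => hi ?_⟩
    have := hb i hbi
    exact S.of_subsingleton_module (M := (localCohomology I i).obj X)
  have hne : A.Nonempty := by
    rw [Set.nonempty_iff_ne_empty]
    intro he
    have : cohomDimWrt S I X = ⊥ := by
      unfold cohomDimWrt
      change ⨆ i ∈ A, _ = _
      simp [he]
    rw [this] at h
    exact absurd h (by simp)
  have hmem : sSup A ∈ A := Nat.sSup_mem hne hbdd
  have heq : cohomDimWrt S I X = (sSup A : ℕ) := by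
    refine le_antisymm (iSup₂_le fun i hi => ?_) (le_iSup₂_of_le (sSup A) hmem le_rfl)
    exact_mod_cast le_csSup hbdd hi
  rw [heq] at h
  have hpos : 0 < sSup A := by exact_mod_cast h
  obtain ⟨n, hn⟩ : ∃ n, sSup A = n + 1 := ⟨sSup A - 1, by lia⟩
  rw [hn] at heq hmem
  refine ⟨n, heq, hmem, fun i hi => by_contra fun hiS => ?_⟩
  have := le_csSup hbdd (show i ∈ A from hiS)
  lia

end localCohomology

/-! ### Maximal submodules and the conclusion. -/

/-- If an ideal acts locally nilpotently on `M`, it maps `M` into every maximal submodule. -/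
lemma smul_top_le_of_isCoatom {R : Type*} [CommRing R] {I : Ideal R} {M : Type*} [AddCommGroup M]
    [Module R M] (ht : ∀ m : M, ∃ k : ℕ, ∀ r ∈ I ^ k, r • m = 0) {P : Submodule R M}
    (hP : IsCoatom P) : I • (⊤ : Submodule R M) ≤ P := by
  refine Submodule.smul_le.2 fun r hr y _ => by_contra fun hy => ?_
  have htop : P ⊔ R ∙ (r • y) = ⊤ :=
    hP.2 _ (lt_of_le_of_ne le_sup_left fun e => hy (e ▸
      Submodule.mem_sup_right (Submodule.mem_span_singleton_self _)))
  obtain ⟨p, hp, q, hq, hpq⟩ := Submodule.mem_sup.1 (htop ▸ Submodule.mem_top : y ∈ P ⊔ R ∙ (r • y))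
  obtain ⟨c, rfl⟩ := Submodule.mem_span_singleton.1 hq
  -- Modulo P, y is fixed by c r and so by all its powers, which eventually kill y. This forces y,
  -- hence r y, into P.
  have hstep : y - (c * r) • y ∈ P := by
    rw [mul_smul, sub_eq_of_eq_add hpq.symm]; exact hp
  have hpow : ∀ k : ℕ, y - (c * r) ^ k • y ∈ P := by
    intro k
    induction k with
    | zero => simp
    | succ k ih =>
      have := P.add_mem ih (P.smul_mem ((c * r) ^ k) hstep)
      rwa [smul_sub, ← mul_smul, ← pow_succ, sub_add_sub_cancel] at this
  obtain ⟨k, hk⟩ := ht y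
  have := hpow k
  rw [hk _ (Ideal.pow_mem_pow (I.mul_mem_left c hr) k), sub_zero] at this
  exact hy (P.smul_mem r this)

theorem corollary3p3 {R : Type u} [CommRing R] [IsNoetherianRing R] (I : Ideal R)
    (X : ModuleCat.{u} R) :
    (∀ (S : ObjectProperty (ModuleCat.{u} R)) [S.IsSerreClass], 0 < cohomDimWrt S I X →
      ∃ d : ℕ, cohomDimWrt S I X = d ∧
        (∀ T : Submodule R ((localCohomology I d).obj X), S (ModuleCat.of R T) →
          ¬ Module.Finite R ((localCohomology I d).obj X ⧸ T)) ∧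
        ¬ Module.Finite R ((localCohomology I d).obj X)) ∧
    (0 < cohomDim I X →
      ∃ d : ℕ, cohomDim I X = d ∧
        (∀ T : Submodule R ((localCohomology I d).obj X), T ≠ ⊤ →
          ¬ IsCoatomicModule R ((localCohomology I d).obj X ⧸ T)) ∧
        ¬ IsCoatomicModule R ((localCohomology I d).obj X)) ∧
    (0 < artinianCohomDim I X →
      ∃ d : ℕ, artinianCohomDim I X = d ∧
        (∀ T : Submodule R ((localCohomology I d).obj X), IsArtinian R T →
          ¬ IsMinimaxModule R ((localCohomology I d).obj X ⧸ T)) ∧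
        ¬ IsMinimaxModule R ((localCohomology I d).obj X)) := by
  refine ⟨?_, ?_, ?_⟩
  · intro S _ h
    obtain ⟨n, hd, hn, hi⟩ := localCohomology.exists_cohomDimWrt_eq h
    have key : ∀ T : Submodule R ((localCohomology I (n + 1)).obj X), S (ModuleCat.of R T) →
        ¬ Module.Finite R ((localCohomology I (n + 1)).obj X ⧸ T) := fun T hT hfin =>
      -- Here F is the whole quotient, so what remains modulo F is zero.
      hn (localCohomology.mem_of_fg_quotient hi hT hfin.fg_top S.of_subsingleton_module)
    exact ⟨n + 1, hd, key, fun hfin => key ⊥ S.of_subsingleton_module inferInstance⟩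
  · intro h
    obtain ⟨n, hd, hn, hi⟩ := localCohomology.exists_cohomDimWrt_eq h
    have htop : (I • ⊤ : Submodule R ((localCohomology I (n + 1)).obj X)) = ⊤ :=
      Submodule.Quotient.subsingleton_iff.1
        (localCohomology.quotient_smul_top_mem I X (zeroModules R) n hi)
    have key : ∀ P : Submodule R ((localCohomology I (n + 1)).obj X), ¬ IsCoatom P := fun P hP =>
      hP.1 (top_le_iff.1 (htop.ge.trans
        (smul_top_le_of_isCoatom (localCohomology.torsion I X n) hP)))
    refine ⟨n + 1, hd, fun T hT hco => ?_, fun hco => ?_⟩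
    · have : Nontrivial ((localCohomology I (n + 1)).obj X ⧸ T) :=
        Submodule.Quotient.nontrivial_iff.2 hT
      -- Coatomicity is used only to produce one maximal submodule of a nonzero module.
      obtain ⟨P, hP, -⟩ := hco ⊥ bot_ne_top
      exact key _ (Submodule.isCoatom_comap_iff T.mkQ_surjective |>.2 hP)
    · have : Nontrivial ((localCohomology I (n + 1)).obj X) := not_subsingleton_iff_nontrivial.1 hn
      obtain ⟨P, hP, -⟩ := hco ⊥ bot_ne_top
      exact key P hP
  · intro h
    obtain ⟨n, hd, hn, hi⟩ := localCohomology.exists_cohomDimWrt_eq h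
    refine ⟨n + 1, hd, fun T hT ⟨F, hF, hTF⟩ => ?_, fun ⟨F, hF, hTF⟩ => ?_⟩
    · exact hn (localCohomology.mem_of_fg_quotient hi hT hF hTF)
    · refine hn ((artinianModules R).of_fg_of_quotient
        ((isNoetherianRing_iff_ideal_fg R).1 inferInstance I) (localCohomology.torsion I X n)
        (localCohomology.quotient_smul_top_mem I X (artinianModules R) n hi) F hF hTF)
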